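/- **Theorem 1 (The triality principle for two B-cylinders).** Let $\varepsilon$ and $g$ be nondegenerate quadratic forms on $\mathbb C^8$, and let $Q_\varepsilon=\{\varepsilon=0\}$, $Q_g=\{g=0\}$ be the corresponding quadrics (B-cylinders) in the projective space $\mathbb{CP}_7$. A *generator* $\mathbb{CP}_k$ of a quadric is a $k$-dimensional projective subspace of $\mathbb{CP}_7$ contained in it. A *family* of generators $\mathbb{CP}_3$ of a quadric consists of all its generators $\mathbb{CP}_3$ which meet a fixed one in a subspace of odd projective dimension ($-1$, $1$ or $3$, where $-1$ means the empty set); each of the two quadrics has such families. Let $F$ be any family of generators $\mathbb{CP}_3$ of $Q_\varepsilon$, and $G$ any family of generators $\mathbb{CP}_3$ of $Q_g$. Then there is a bilinear map $\eta:\mathbb C^8\times\mathbb C^8\to\mathbb C^8$ such that the following holds, where a point $[x]$ of the first copy of $\mathbb{CP}_7$ (containing $Q_\varepsilon$) and a point $[r]$ of the second copy (containing $Q_g$) are called incident if $\eta(x,r)=0$, and where a generator $W$ of $Q_\varepsilon$ is said to define the point $R$ if $R$ is the one and only point incident with all points of $W$. 1. Each $\mathbb{CP}_3$ of the family $F$ of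 $Q_\varepsilon$ defines a point $R$ of $Q_g$, and each point of $Q_g$ is defined by exactly one $\mathbb{CP}_3$ of $F$. 2. Each generator $\mathbb{CP}_2$ of $Q_\varepsilon$ defines a point of $Q_g$. If $U\in F$ defines the point $R$, then the generators $\mathbb{CP}_2$ which define $R$ are exactly the generators $\mathbb{CP}_2$ contained in $U$. 3. For each generator $\mathbb{CP}_1$ of $Q_\varepsilon$, the points incident with all its points form a generator $\mathbb{CP}_1$ of $Q_g$, and this is a one-to-one correspondence between all generators $\mathbb{CP}_1$ of $Q_\varepsilon$ and all generators $\mathbb{CP}_1$ of $Q_g$. If $U\in F$ defines the point $R$, then the generators $\mathbb{CP}_1$ contained in $U$ correspond exactly to the generators $\mathbb{CP}_1$ of $Q_g$ passing through $R$ (the beam centered at $R$). With the same incidence relation, the same statements hold with the two quadrics interchanged, that is, for passing from generators of $Q_g$ to $Q_\varepsilon$ with the family $G$ in place of $F$. -/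

import Mathlib

open Module
open scoped LinearAlgebra.Projectivization

/-- Seven-dimensional complex projective space. -/
abbrev CP7 : Type := ℙ ℂ (Fin 8 → ℂ)

/-- The quadric `q = 0` in `CP7`. -/
def quadric (q : QuadraticForm ℂ (Fin 8 → ℂ)) : Set CP7 := {p | q p.rep = 0}

/-- Membership in the quadric may be tested on any vector representing the point. -/
theorem mk_mem_quadric (q : QuadraticForm ℂ (Fin 8 → ℂ)) (v : Fin 8 → ℂ) (hv : v ≠ 0) :
    Projectivization.mk ℂ v hv ∈ quadric q ↔ q v = 0 := by
  obtain ⟨a, ha⟩ := Projectivization.exists_smul_eq_mk_rep ℂ v hv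
  have h : q (Projectivization.mk ℂ v hv).rep = (a : ℂ) * (a : ℂ) * q v := by
    rw [← ha, Units.smul_def, QuadraticMap.map_smul, smul_eq_mul]
  simp [quadric, h]

/-- A generator of dimension `k` of the quadric `q = 0`: a projective subspace of `CP7` of
projective dimension `k` (given by a linear subspace of dimension `k + 1`), all of whose points
lie on the quadric. -/
def IsGenerator (q : QuadraticForm ℂ (Fin 8 → ℂ)) (k : ℕ)
    (W : Submodule ℂ (Fin 8 → ℂ)) : Prop :=
  finrank ℂ W = k + 1 ∧ ∀ p : CP7, p.submodule ≤ W → p ∈ quadric q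

/-- A family of three-dimensional generators: all those which meet a fixed one
in a linear subspace of even dimension, that is, in a projective subspace of
odd dimension (`-1`, `1` or `3`). A nonsingular quadric in `CP7` has two families. -/
def IsFamily (q : QuadraticForm ℂ (Fin 8 → ℂ)) (F : Set (Submodule ℂ (Fin 8 → ℂ))) : Prop :=
  ∃ U, IsGenerator q 3 U ∧
    F = {W | IsGenerator q 3 W ∧ Even (finrank ℂ (U ⊓ W : Submodule ℂ (Fin 8 → ℂ)))}

/-- The subspace of all `r` incident with every `x` in `W`, where `x` and `r` are incident
when `η x r = 0`. -/
def incidentTo (η : (Fin 8 → ℂ) →ₗ[ℂ] (Fin 8 → ℂ) →ₗ[ℂ] (Fin 8 → ℂ))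
    (W : Submodule ℂ (Fin 8 → ℂ)) : Submodule ℂ (Fin 8 → ℂ) where
  carrier := {r | ∀ x ∈ W, η x r = 0}
  zero_mem' := fun x _ => map_zero (η x)
  add_mem' := fun {a b} ha hb x hx => by rw [map_add, ha x hx, hb x hx, add_zero]
  smul_mem' := fun c a ha x hx => by rw [map_smul, ha x hx, smul_zero]

/-- `W` defines the point `R`: it is the one and only point incident with all points of `W`. -/
def DefinesPoint (η : (Fin 8 → ℂ) →ₗ[ℂ] (Fin 8 → ℂ) →ₗ[ℂ] (Fin 8 → ℂ))
    (W : Submodule ℂ (Fin 8 → ℂ)) (R : CP7) : Prop :=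
  incidentTo η W = R.submodule

/-- The passage from the generators of the quadric `q = 0` to the quadric `q' = 0` by means of
the incidence `η x r = 0`, for the three-dimensional generators of the family `F`. -/
structure TrialityPassage (η : (Fin 8 → ℂ) →ₗ[ℂ] (Fin 8 → ℂ) →ₗ[ℂ] (Fin 8 → ℂ))
    (q q' : QuadraticForm ℂ (Fin 8 → ℂ)) (F : Set (Submodule ℂ (Fin 8 → ℂ))) : Prop where
  /-- A `CP3` of the family defines a point of the other quadric. -/
  point_of_space : ∀ U ∈ F, ∃ R ∈ quadric q', DefinesPoint η U R
  /-- Each point of the other quadric is defined by exactly one `CP3` of the family. -/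
  space_of_point : ∀ R ∈ quadric q', ∃! U, U ∈ F ∧ DefinesPoint η U R
  /-- A `CP2` defines a point of the other quadric. -/
  point_of_plane : ∀ P, IsGenerator q 2 P → ∃ R ∈ quadric q', DefinesPoint η P R
  /-- The `CP2`s defining the point `R` are those lying in the `CP3` which defines `R`. -/
  planes_of_point : ∀ U ∈ F, ∀ R, DefinesPoint η U R →
    {P | IsGenerator q 2 P ∧ DefinesPoint η P R} = {P | IsGenerator q 2 P ∧ P ≤ U}
  /-- The `CP1`s of the two quadrics correspond one-to-one. -/
  lines : Set.BijOn (incidentTo η) {l | IsGenerator q 1 l} {m | IsGenerator q' 1 m}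
  /-- The `CP1`s in a `CP3` correspond to the `CP1`s of the other quadric through the point
  defined by that `CP3`. -/
  beam : ∀ U ∈ F, ∀ R, DefinesPoint η U R →
    incidentTo η '' {l | IsGenerator q 1 l ∧ l ≤ U} =
      {m | IsGenerator q' 1 m ∧ R.submodule ≤ m}

/-!
The incidence relation is the vanishing of the octonion product `σ x * τ r`, where `σ` and `τ` are
isometries of the two quadratic forms with the complex octonion norm. All that is used of the
octonions is alternativity, in the form `x̄ (x y) = N(x) y` and `(x y) ȳ = N(y) x`. The first
identity makes two copies of `ℂ⁸` into the half-spin modules of the Clifford algebra of the first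
quadratic form (`IsCliffordPair`), and the second one does the same for the second form; the two
roles are exchanged by flipping the product.

For a totally isotropic subspace `W`, the vectors incident with all of `W` are those annihilated by
`W` in one half-spin module. Adding a vector to `W` splits the annihilator in one module into the
two annihilators of the larger space (`finrank_incidentTo_add_of_polar_ne_zero`), and a nonnull
vector orthogonal to `W` identifies the two annihilators (`finrank_incidentTo_eq`). Hence the
annihilators of totally isotropic subspaces of dimension `1`, `2`, `3` have dimension `4`, `2`, `1`,
while those of a maximal one have dimension `1` in one half-spin module and `0` in the other. Which
of the two is nonzero changes between maximal subspaces meeting in a hyperplane, so that it is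
determined by the family (`finrank_incidentTo_eq_iff_even`).

The annihilator of a nonzero subspace is totally isotropic for the other form, because
`(x y) ȳ = 0` forces `N(y) = 0`. The passages in the two directions form a Galois connection, and
comparing dimensions shows that they are mutually inverse where the theorem says so
(`trialityPassage_of_isCliffordPair`). If a prescribed family is the one whose members have no
incident point, then `σ` is followed by octonion conjugation, which exchanges the half-spin modules
(`exists_isometry_finrank_incidentTo_eq_one`); in the same way `τ` takes care of the family of the
second quadric.
-/

local notation "𝕍" => Fin 8 → ℂ

/-! ### Totally isotropic subspaces -/

/-- A subspace on which the quadratic form vanishes identically. -/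
def IsTotallyIsotropic (q : QuadraticForm ℂ 𝕍) (W : Submodule ℂ 𝕍) : Prop :=
  ∀ x ∈ W, q x = 0

theorem isGenerator_iff {q : QuadraticForm ℂ 𝕍} {k : ℕ} {W : Submodule ℂ 𝕍} :
    IsGenerator q k W ↔ finrank ℂ W = k + 1 ∧ IsTotallyIsotropic q W := by
  refine and_congr_right fun _ => ⟨fun h x hx => ?_, fun h p hp => ?_⟩
  · by_cases hx0 : x = 0
    · simp [hx0]
    · refine (mk_mem_quadric q x hx0).1 (h _ ?_)
      rwa [Projectivization.submodule_mk, Submodule.span_singleton_le_iff_mem]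
  · rw [Projectivization.submodule_eq, Submodule.span_singleton_le_iff_mem] at hp
    exact h _ hp

section Isotropic

variable {q : QuadraticForm ℂ 𝕍} {U W : Submodule ℂ 𝕍}

theorem IsTotallyIsotropic.mono (hW : IsTotallyIsotropic q W) (h : U ≤ W) :
    IsTotallyIsotropic q U := fun x hx => hW x (h hx)

theorem IsTotallyIsotropic.polar_eq_zero (hW : IsTotallyIsotropic q W) {x y : 𝕍}
    (hx : x ∈ W) (hy : y ∈ W) : QuadraticMap.polar q x y = 0 := by
  simp [QuadraticMap.polar, hW _ (W.add_mem hx hy), hW _ hx, hW _ hy]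

theorem isTotallyIsotropic_span_singleton {x : 𝕍} (hx : q x = 0) :
    IsTotallyIsotropic q (Submodule.span ℂ {x}) := by
  intro y hy
  obtain ⟨c, rfl⟩ := Submodule.mem_span_singleton.1 hy
  simp [QuadraticMap.map_smul, hx]

theorem IsTotallyIsotropic.sup_span_singleton (hW : IsTotallyIsotropic q W) {w : 𝕍}
    (hw : q w = 0) (hWw : ∀ x ∈ W, QuadraticMap.polar q w x = 0) :
    IsTotallyIsotropic q (W ⊔ Submodule.span ℂ {w}) := by
  intro y hy
  obtain ⟨x, hx, z, hz, rfl⟩ := Submodule.mem_sup.1 hy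
  obtain ⟨c, rfl⟩ := Submodule.mem_span_singleton.1 hz
  rw [QuadraticMap.map_add q, hW x hx, QuadraticMap.map_smul, hw, QuadraticMap.polar_comm,
    QuadraticMap.polar_smul_left, hWw x hx]
  simp

theorem polarBilin_nondegenerate
    (hq : (QuadraticMap.associated (R := ℂ) q).Nondegenerate) : q.polarBilin.Nondegenerate := by
  have h : ∀ x y, q.polarBilin x y = 2 * QuadraticMap.associated (R := ℂ) q x y := by
    intro x y
    rw [two_mul, ← two_nsmul]
    exact (LinearMap.congr_fun₂ (QuadraticMap.two_nsmul_associated ℂ q) x y).symm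
  exact ⟨fun x hx => hq.1 x fun y => by simpa [h] using hx y,
    fun x hx => hq.2 x fun y => by simpa [h] using hx y⟩

theorem IsTotallyIsotropic.finrank_le_four (hq : q.polarBilin.Nondegenerate)
    (hW : IsTotallyIsotropic q W) : finrank ℂ W ≤ 4 := by
  have h := LinearMap.BilinForm.finrank_orthogonal hq W
  have h1 : W ≤ LinearMap.BilinForm.orthogonal q.polarBilin W := fun x hx =>
    LinearMap.BilinForm.mem_orthogonal_iff.2 fun y hy => hW.polar_eq_zero hy hx
  have h2 := Submodule.finrank_mono h1
  have h3 : finrank ℂ 𝕍 = 8 := by simp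
  omega

/-- A totally isotropic subspace that is not maximal has an orthogonal vector off the quadric. -/
theorem exists_orthogonal_ne_zero (hq : q.polarBilin.Nondegenerate) (hk : finrank ℂ W < 4) :
    ∃ w, q w ≠ 0 ∧ ∀ x ∈ W, QuadraticMap.polar q x w = 0 := by
  by_contra! hcon
  have h : IsTotallyIsotropic q (LinearMap.BilinForm.orthogonal q.polarBilin W) := by
    intro x hx
    by_contra hx0
    obtain ⟨y, hy, hxy⟩ := hcon x hx0
    exact hxy (LinearMap.BilinForm.mem_orthogonal_iff.1 hx y hy)
  have h1 := h.finrank_le_four hq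
  have h2 := LinearMap.BilinForm.finrank_orthogonal hq W
  have h3 : finrank ℂ 𝕍 = 8 := by simp
  omega

theorem finrank_inf_ker_add_one (W : Submodule ℂ 𝕍) (f : 𝕍 →ₗ[ℂ] ℂ) {y : 𝕍} (hy : y ∈ W)
    (hfy : f y ≠ 0) : finrank ℂ (W ⊓ LinearMap.ker f : Submodule ℂ 𝕍) + 1 = finrank ℂ W := by
  have hy' : y ∉ W ⊓ LinearMap.ker f := fun h => hfy h.2
  rw [← Submodule.finrank_sup_span_singleton hy']
  suffices h : W ⊓ LinearMap.ker f ⊔ Submodule.span ℂ {y} = W by rw [h]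
  refine le_antisymm (sup_le inf_le_left ?_) fun x hx => ?_
  · rwa [Submodule.span_singleton_le_iff_mem]
  · refine Submodule.mem_sup.2 ⟨x - (f x / f y) • y, ⟨W.sub_mem hx (W.smul_mem _ hy), ?_⟩,
      (f x / f y) • y, Submodule.smul_mem _ _ (Submodule.mem_span_singleton_self y), by simp⟩
    simp [hfy]

/-- Two distinct maximal totally isotropic subspaces `U`, `W` are joined through a third one that
meets `U` in a hyperplane and meets `W` in one dimension more than `U` does. It is spanned by a
vector `w` of `W` outside `U` and the vectors of `U` orthogonal to `w`. -/
theorem exists_adjacent (hq : q.polarBilin.Nondegenerate)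
    (hU : IsTotallyIsotropic q U) (hU4 : finrank ℂ U = 4) (hW : IsTotallyIsotropic q W)
    {w : 𝕍} (hwW : w ∈ W) (hwU : w ∉ U) :
    ∃ W', IsTotallyIsotropic q W' ∧ finrank ℂ W' = 4 ∧
      finrank ℂ (U ⊓ W' : Submodule ℂ 𝕍) = 3 ∧
      finrank ℂ (W' ⊓ W : Submodule ℂ 𝕍) = finrank ℂ (U ⊓ W : Submodule ℂ 𝕍) + 1 := by
  obtain ⟨u, huU, hu⟩ : ∃ u ∈ U, q.polarBilin w u ≠ 0 := by
    by_contra! hcon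
    have h := (hU.sup_span_singleton (hW w hwW) hcon).finrank_le_four hq
    rw [Submodule.finrank_sup_span_singleton hwU] at h
    omega
  have h0 := finrank_inf_ker_add_one U (q.polarBilin w) huU hu
  set U₀ := U ⊓ LinearMap.ker (q.polarBilin w) with hU₀
  have hw0 : w ∉ U₀ := fun h => hwU h.1
  have hspan : Submodule.span ℂ {w} ≤ W := by rwa [Submodule.span_singleton_le_iff_mem]
  refine ⟨U₀ ⊔ Submodule.span ℂ {w},
    (hU.mono inf_le_left).sup_span_singleton (hW w hwW) (fun x hx => hx.2), ?_, ?_, ?_⟩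
  · rw [Submodule.finrank_sup_span_singleton hw0]; omega
  · have hle : U₀ ≤ U ⊓ (U₀ ⊔ Submodule.span ℂ {w}) := le_inf inf_le_left le_sup_left
    have hlt : U ⊓ (U₀ ⊔ Submodule.span ℂ {w}) < U₀ ⊔ Submodule.span ℂ {w} :=
      lt_of_le_of_ne inf_le_right fun h =>
        hwU (inf_eq_right.1 h (Submodule.mem_sup_right (Submodule.mem_span_singleton_self w)))
    have h1 := Submodule.finrank_mono hle
    have h2 := Submodule.finrank_lt_finrank_of_lt hlt
    rw [Submodule.finrank_sup_span_singleton hw0] at h2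
    omega
  · have h1 : (U₀ ⊔ Submodule.span ℂ {w}) ⊓ W = (U ⊓ W) ⊔ Submodule.span ℂ {w} := by
      rw [sup_comm U₀, sup_inf_assoc_of_le U₀ hspan, sup_comm]
      congr 1
      refine le_antisymm (inf_le_inf_right W inf_le_left) fun x hx => ⟨⟨hx.1, ?_⟩, hx.2⟩
      exact hW.polar_eq_zero hwW hx.2
    rw [h1, Submodule.finrank_sup_span_singleton fun h : w ∈ U ⊓ W => hwU h.1]

end Isotropic

/-! ### Clifford pairs and the incident subspaces -/

/-- Two bilinear maps that form a Clifford module structure for `q`: on the direct sum of the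
second argument space and the value space, a vector `x` acts by interchanging the summands through
`φ x` and `ψ x`, and its square is `q x`. -/
structure IsCliffordPair (q : QuadraticForm ℂ 𝕍) (φ ψ : 𝕍 →ₗ[ℂ] 𝕍 →ₗ[ℂ] 𝕍) : Prop where
  left : ∀ x r, ψ x (φ x r) = q x • r
  right : ∀ x s, φ x (ψ x s) = q x • s

section Incident

variable {q q' : QuadraticForm ℂ 𝕍} {φ ψ ρ : 𝕍 →ₗ[ℂ] 𝕍 →ₗ[ℂ] 𝕍} {U W : Submodule ℂ 𝕍}

theorem mem_incidentTo {r : 𝕍} : r ∈ incidentTo φ W ↔ ∀ x ∈ W, φ x r = 0 := Iff.rfl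

theorem incidentTo_anti (h : U ≤ W) : incidentTo φ W ≤ incidentTo φ U :=
  fun _ hr x hx => hr x (h hx)

theorem le_incidentTo_flip : W ≤ incidentTo φ.flip (incidentTo φ W) :=
  fun x hx _ hr => hr x hx

namespace IsCliffordPair

theorem symm (h : IsCliffordPair q φ ψ) : IsCliffordPair q ψ φ := ⟨h.right, h.left⟩

theorem polar (h : IsCliffordPair q φ ψ) (x y r : 𝕍) :
    ψ x (φ y r) + ψ y (φ x r) = QuadraticMap.polar q x y • r := by
  have h1 := h.left (x + y) r
  simp only [map_add, LinearMap.add_apply, h.left] at h1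
  rw [QuadraticMap.polar, sub_smul, sub_smul, ← h1]
  abel

theorem isTotallyIsotropic_of_mem_incidentTo (h : IsCliffordPair q φ ψ) {r : 𝕍} (hr : r ≠ 0)
    (hrW : r ∈ incidentTo φ W) : IsTotallyIsotropic q W := by
  intro x hx
  have h1 := h.left x r
  rw [hrW x hx, map_zero] at h1
  exact (smul_eq_zero.1 h1.symm).resolve_right hr

theorem isTotallyIsotropic_incidentTo (h : IsCliffordPair q' φ.flip ρ) (hW : W ≠ ⊥) :
    IsTotallyIsotropic q' (incidentTo φ W) := by
  obtain ⟨x, hx, hx0⟩ := W.exists_mem_ne_zero_of_ne_bot hW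
  exact h.isTotallyIsotropic_of_mem_incidentTo hx0 (le_incidentTo_flip hx)

theorem finrank_incidentTo_le (h : IsCliffordPair q φ ψ) {w : 𝕍} (hw : q w ≠ 0)
    (hwW : ∀ x ∈ W, QuadraticMap.polar q x w = 0) :
    finrank ℂ (incidentTo φ W) ≤ finrank ℂ (incidentTo ψ W) := by
  have hmap : ∀ r ∈ incidentTo φ W, φ w r ∈ incidentTo ψ W := by
    intro r hr x hx
    have := h.polar x w r
    rwa [hr x hx, map_zero, add_zero, hwW x hx, zero_smul] at this
  refine LinearMap.finrank_le_finrank_of_injective (f := (φ w).restrict hmap) ?_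
  rw [← LinearMap.ker_eq_bot, LinearMap.ker_eq_bot']
  intro r hr
  have h0 : φ w r = 0 := congrArg Subtype.val hr
  have h1 := h.left w r
  rw [h0, map_zero] at h1
  exact Subtype.ext ((smul_eq_zero.1 h1.symm).resolve_left hw)

/-- Below the maximal dimension the two incident subspaces have the same dimension, because a
vector off the quadric and orthogonal to `W` interchanges them. -/
theorem finrank_incidentTo_eq (h : IsCliffordPair q φ ψ) (hq : q.polarBilin.Nondegenerate)
    (hk : finrank ℂ W < 4) :
    finrank ℂ (incidentTo φ W) = finrank ℂ (incidentTo ψ W) := by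
  obtain ⟨w, hw, hwW⟩ := exists_orthogonal_ne_zero hq hk
  exact (h.finrank_incidentTo_le hw hwW).antisymm (h.symm.finrank_incidentTo_le hw hwW)

/-- If `z` pairs nontrivially with `y ∈ W`, then `y` maps one incident subspace of the hyperplane
`W ∩ z^⊥` into the other one; its kernel and its range are the two incident subspaces of `W`. -/
theorem finrank_incidentTo_add_of_polar_ne_zero (h : IsCliffordPair q φ ψ)
    (hW : IsTotallyIsotropic q W) {y z : 𝕍} (hy : y ∈ W) (hzy : q.polarBilin z y ≠ 0) :
    finrank ℂ (incidentTo φ W) + finrank ℂ (incidentTo ψ W) =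
      finrank ℂ (incidentTo ψ (W ⊓ LinearMap.ker (q.polarBilin z))) := by
  set W₀ := W ⊓ LinearMap.ker (q.polarBilin z) with hW₀
  have hsplit : ∀ x ∈ W, ∃ x₀ ∈ W₀, ∃ c : ℂ, x = x₀ + c • y := by
    intro x hx
    refine ⟨x - (q.polarBilin z x / q.polarBilin z y) • y,
      ⟨W.sub_mem hx (W.smul_mem _ hy), ?_⟩, q.polarBilin z x / q.polarBilin z y, by simp⟩
    rw [SetLike.mem_coe, LinearMap.mem_ker, map_sub, map_smul, smul_eq_mul,
      div_mul_cancel₀ _ hzy, sub_self]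
  rw [← LinearMap.finrank_range_add_finrank_ker ((ψ y).domRestrict (incidentTo ψ W₀))]
  have hrange : incidentTo φ W = LinearMap.range ((ψ y).domRestrict (incidentTo ψ W₀)) := by
    refine le_antisymm (fun r hr => ?_) ?_
    · refine ⟨⟨(QuadraticMap.polar q z y)⁻¹ • φ z r, Submodule.smul_mem _ _ fun x hx => ?_⟩, ?_⟩
      · have h1 := h.polar x z r
        rw [hr x hx.1, map_zero, add_zero, QuadraticMap.polar_comm,
          show QuadraticMap.polar q z x = 0 from hx.2, zero_smul] at h1
        exact h1
      · have h1 := h.polar y z r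
        rw [hr y hy, map_zero, add_zero, QuadraticMap.polar_comm] at h1
        rw [LinearMap.domRestrict_apply, map_smul, h1]
        exact inv_smul_smul₀ hzy r
    · rintro _ ⟨⟨s, hs⟩, rfl⟩ x hx
      obtain ⟨x₀, hx₀, c, rfl⟩ := hsplit x hx
      have h1 := h.symm.polar x₀ y s
      rw [hs x₀ hx₀, map_zero, add_zero, hW.polar_eq_zero hx₀.1 hy, zero_smul] at h1
      simp [h1, h.right, hW y hy]
  have hker : incidentTo ψ W = (LinearMap.ker ((ψ y).domRestrict (incidentTo ψ W₀))).map
      (incidentTo ψ W₀).subtype := by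
    refine le_antisymm (fun s hs => ?_) ?_
    · exact ⟨⟨s, incidentTo_anti inf_le_left hs⟩, hs y hy, rfl⟩
    · rintro _ ⟨⟨s, hs⟩, hsy, rfl⟩ x hx
      obtain ⟨x₀, hx₀, c, rfl⟩ := hsplit x hx
      have h1 : ψ y s = 0 := hsy
      simp [hs x₀ hx₀, h1]
  rw [← hrange, hker, Submodule.finrank_map_subtype_eq]

/-- The dimension count of `finrank_incidentTo_add_of_polar_ne_zero` for some hyperplane. -/
theorem exists_finrank_incidentTo_add (h : IsCliffordPair q φ ψ)
    (hq : q.polarBilin.Nondegenerate) (hW : IsTotallyIsotropic q W) {k : ℕ}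
    (hk : finrank ℂ W = k + 1) :
    ∃ W₀ ≤ W, finrank ℂ W₀ = k ∧
      finrank ℂ (incidentTo φ W) + finrank ℂ (incidentTo ψ W) = finrank ℂ (incidentTo ψ W₀) := by
  have hbot : W ≠ ⊥ := by rintro rfl; simp at hk
  obtain ⟨y, hy, hy0⟩ := W.exists_mem_ne_zero_of_ne_bot hbot
  obtain ⟨z, hz⟩ : ∃ z, q.polarBilin z y ≠ 0 := by
    by_contra! hcon
    exact hy0 (hq.2 y hcon)
  have h1 := finrank_inf_ker_add_one W _ hy hz
  exact ⟨_, inf_le_left, by omega, h.finrank_incidentTo_add_of_polar_ne_zero hW hy hz⟩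

/-- The subspace incident with a totally isotropic subspace has half the dimension of that incident
with a hyperplane of it, as long as the maximal dimension is not reached. -/
theorem finrank_incidentTo (h : IsCliffordPair q φ ψ) (hq : q.polarBilin.Nondegenerate) {k : ℕ}
    (hk : k < 3) (hW : IsTotallyIsotropic q W) (hWk : finrank ℂ W = k + 1) :
    finrank ℂ (incidentTo φ W) = 2 ^ (2 - k) := by
  induction k generalizing W with
  | zero =>
    obtain ⟨W₀, -, hW₀, hadd⟩ := h.exists_finrank_incidentTo_add hq hW hWk
    have heq := h.finrank_incidentTo_eq hq (W := W) (by omega)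
    have htop : incidentTo ψ W₀ = ⊤ := by
      rw [Submodule.finrank_eq_zero.1 hW₀, eq_top_iff]
      rintro s - x hx
      simp [(Submodule.mem_bot ℂ).1 hx]
    rw [htop, finrank_top, finrank_fin_fun] at hadd
    simp only [Nat.sub_zero]
    omega
  | succ k ih =>
    obtain ⟨W₀, hle, hW₀, hadd⟩ := h.exists_finrank_incidentTo_add hq hW hWk
    have heq := h.finrank_incidentTo_eq hq (W := W) (by omega)
    have heq₀ := h.finrank_incidentTo_eq hq (W := W₀) (by omega)
    have h1 := ih (by omega) (hW.mono hle) hW₀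
    have h2 : 2 ^ (2 - k) = 2 * 2 ^ (2 - (k + 1)) := by
      rw [← pow_succ']; congr 1; omega
    omega

/-- A maximal totally isotropic subspace has an incident point for exactly one of the two members of
a Clifford pair, and only one such point. -/
theorem finrank_incidentTo_add_eq_one (h : IsCliffordPair q φ ψ)
    (hq : q.polarBilin.Nondegenerate) (hW : IsTotallyIsotropic q W) (hW4 : finrank ℂ W = 4) :
    finrank ℂ (incidentTo φ W) + finrank ℂ (incidentTo ψ W) = 1 := by
  obtain ⟨W₀, hle, hW₀, hadd⟩ := h.exists_finrank_incidentTo_add hq (k := 3) hW hW4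
  rw [hadd, h.symm.finrank_incidentTo hq (k := 2) (by omega) (hW.mono hle) hW₀]
  simp

/-- If two maximal totally isotropic subspaces meeting in a hyperplane both had an incident point,
it would be the single point incident with their intersection, hence incident with their sum. The
sum would then be totally isotropic, but it has dimension five. -/
theorem not_finrank_incidentTo_eq_one (h : IsCliffordPair q φ ψ)
    (hq : q.polarBilin.Nondegenerate) (hU : IsTotallyIsotropic q U) (hU4 : finrank ℂ U = 4)
    (hW4 : finrank ℂ W = 4)
    (hUW : finrank ℂ (U ⊓ W : Submodule ℂ 𝕍) = 3) (h1 : finrank ℂ (incidentTo φ U) = 1) :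
    finrank ℂ (incidentTo φ W) ≠ 1 := by
  intro h2
  have h3 : finrank ℂ (incidentTo φ (U ⊓ W)) = 1 :=
    h.finrank_incidentTo hq (k := 2) (by omega) (hU.mono inf_le_left) hUW
  have hUeq := Submodule.eq_of_le_of_finrank_eq
    (incidentTo_anti (φ := φ) (inf_le_left : U ⊓ W ≤ U)) (h1.trans h3.symm)
  have hWeq := Submodule.eq_of_le_of_finrank_eq
    (incidentTo_anti (φ := φ) (inf_le_right : U ⊓ W ≤ W)) (h2.trans h3.symm)
  obtain ⟨r, hr, hr0⟩ := (incidentTo φ U).exists_mem_ne_zero_of_ne_bot fun hbot => by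
    rw [hbot] at h1; simp at h1
  have hrW : r ∈ incidentTo φ W := by rwa [hWeq, ← hUeq]
  have hr' : r ∈ incidentTo φ (U ⊔ W) := by
    intro x hx
    obtain ⟨u, hu, w, hw, rfl⟩ := Submodule.mem_sup.1 hx
    simp [hr u hu, hrW w hw]
  have h5 := (h.isTotallyIsotropic_of_mem_incidentTo hr0 hr').finrank_le_four hq
  have h6 := Submodule.finrank_sup_add_finrank_inf_eq U W
  omega

/-- Two maximal totally isotropic subspaces have incident points for the same member of the
Clifford pair precisely when their intersection has even dimension: passing to an adjacent subspace
changes both parities. -/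
theorem finrank_incidentTo_eq_iff_even (h : IsCliffordPair q φ ψ)
    (hq : q.polarBilin.Nondegenerate) (hU : IsTotallyIsotropic q U) (hU4 : finrank ℂ U = 4)
    (hW : IsTotallyIsotropic q W) (hW4 : finrank ℂ W = 4) :
    finrank ℂ (incidentTo φ U) = finrank ℂ (incidentTo φ W) ↔
      Even (finrank ℂ (U ⊓ W : Submodule ℂ 𝕍)) := by
  obtain ⟨n, hn⟩ : ∃ n, finrank ℂ (U ⊓ W : Submodule ℂ 𝕍) + n = 4 :=
    ⟨4 - _, Nat.add_sub_cancel' (hU4 ▸ Submodule.finrank_mono inf_le_left)⟩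
  induction n generalizing U with
  | zero =>
    have h1 : U ⊓ W = U := Submodule.eq_of_le_of_finrank_eq inf_le_left (by omega)
    have h2 : U ⊓ W = W := Submodule.eq_of_le_of_finrank_eq inf_le_right (by omega)
    have hUW : U = W := h1.symm.trans h2
    subst hUW
    rw [h1, hU4]
    exact iff_of_true rfl ⟨2, rfl⟩
  | succ n ih =>
    obtain ⟨w, hwW, hwU⟩ : ∃ w ∈ W, w ∉ U := by
      by_contra! hcon
      have h1 : U ⊓ W = W := inf_eq_right.2 hcon
      rw [h1] at hn
      omega
    obtain ⟨W', hW', hW'4, hUW', hW'W⟩ := exists_adjacent hq hU hU4 hW hwW hwU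
    have hrec := ih hW' hW'4 (by omega)
    rw [hW'W, Nat.even_add_one] at hrec
    have sU := h.finrank_incidentTo_add_eq_one hq hU hU4
    have sW := h.finrank_incidentTo_add_eq_one hq hW hW4
    have sW' := h.finrank_incidentTo_add_eq_one hq hW' hW'4
    have d1 := h.not_finrank_incidentTo_eq_one hq hU hU4 hW'4 hUW'
    have d2 := h.symm.not_finrank_incidentTo_eq_one hq hU hU4 hW'4 hUW'
    rw [← not_iff_not, ← hrec]
    omega

end IsCliffordPair

end Incident

/-! ### The passage between the two quadrics -/

section Passage

variable {q q' : QuadraticForm ℂ 𝕍} {η ψ ρ : 𝕍 →ₗ[ℂ] 𝕍 →ₗ[ℂ] 𝕍} {W : Submodule ℂ 𝕍}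

theorem isTotallyIsotropic_submodule_iff {R : CP7} :
    IsTotallyIsotropic q R.submodule ↔ R ∈ quadric q := by
  rw [Projectivization.submodule_eq]
  exact ⟨fun h => h _ (Submodule.mem_span_singleton_self _), isTotallyIsotropic_span_singleton⟩

theorem exists_definesPoint (h' : IsCliffordPair q' η.flip ρ) (hW : W ≠ ⊥)
    (h1 : finrank ℂ (incidentTo η W) = 1) : ∃ R ∈ quadric q', DefinesPoint η W R := by
  refine ⟨Projectivization.mk'' _ h1, ?_, (Projectivization.submodule_mk'' _ h1).symm⟩
  rw [← isTotallyIsotropic_submodule_iff, Projectivization.submodule_mk'']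
  exact h'.isTotallyIsotropic_incidentTo hW

theorem ne_bot_of_finrank_eq_succ {k : ℕ} (h : finrank ℂ W = k + 1) : W ≠ ⊥ := by
  rintro rfl
  simp at h

/-- The points incident with a given point of the second quadric form a maximal generator of the
first one. -/
theorem isGenerator_incidentTo_flip_submodule (h : IsCliffordPair q η ψ)
    (h' : IsCliffordPair q' η.flip ρ) (hq' : q'.polarBilin.Nondegenerate) {R : CP7}
    (hR : R ∈ quadric q') : IsGenerator q 3 (incidentTo η.flip R.submodule) :=
  isGenerator_iff.2 ⟨h'.finrank_incidentTo hq' (k := 0) (by omega)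
      (isTotallyIsotropic_submodule_iff.2 hR) R.finrank_submodule,
    IsCliffordPair.isTotallyIsotropic_incidentTo (ρ := ψ) (q' := q) (by exact h)
      (ne_bot_of_finrank_eq_succ R.finrank_submodule)⟩

theorem isGenerator_one_incidentTo (h : IsCliffordPair q η ψ)
    (h' : IsCliffordPair q' η.flip ρ) (hq : q.polarBilin.Nondegenerate)
    (hW : IsGenerator q 1 W) : IsGenerator q' 1 (incidentTo η W) := by
  rw [isGenerator_iff] at hW ⊢
  exact ⟨h.finrank_incidentTo hq (k := 1) (by omega) hW.2 hW.1,
    h'.isTotallyIsotropic_incidentTo (ne_bot_of_finrank_eq_succ hW.1)⟩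

theorem incidentTo_flip_incidentTo_of_isGenerator_one (h : IsCliffordPair q η ψ)
    (h' : IsCliffordPair q' η.flip ρ) (hq : q.polarBilin.Nondegenerate)
    (hq' : q'.polarBilin.Nondegenerate) (hW : IsGenerator q 1 W) :
    incidentTo η.flip (incidentTo η W) = W := by
  have h1 := isGenerator_one_incidentTo h h' hq hW
  have h2 := isGenerator_one_incidentTo h' (ρ := ψ) (by exact h) hq' h1
  exact (Submodule.eq_of_le_of_finrank_eq le_incidentTo_flip (hW.1.trans h2.1.symm)).symm

/-- A bilinear map that forms a Clifford pair in either argument gives the triality passage for the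
family of those maximal generators that have an incident point. -/
theorem trialityPassage_of_isCliffordPair (h : IsCliffordPair q η ψ)
    (h' : IsCliffordPair q' η.flip ρ) (hq : q.polarBilin.Nondegenerate)
    (hq' : q'.polarBilin.Nondegenerate) {F : Set (Submodule ℂ 𝕍)}
    (hF : ∀ U, U ∈ F ↔ IsGenerator q 3 U ∧ finrank ℂ (incidentTo η U) = 1) :
    TrialityPassage η q q' F := by
  -- a maximal generator that defines a point consists of all points incident with that point
  have hflip : ∀ U, IsGenerator q 3 U → ∀ R, DefinesPoint η U R →
      incidentTo η.flip R.submodule = U := by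
    intro U hU R hUR
    have hR : R ∈ quadric q' := by
      rw [← isTotallyIsotropic_submodule_iff, ← hUR]
      exact h'.isTotallyIsotropic_incidentTo (ne_bot_of_finrank_eq_succ hU.1)
    have hle : U ≤ incidentTo η.flip R.submodule := hUR ▸ le_incidentTo_flip
    exact (Submodule.eq_of_le_of_finrank_eq hle
      (hU.1.trans (isGenerator_incidentTo_flip_submodule h h' hq' hR).1.symm)).symm
  have hplane : ∀ P, IsGenerator q 2 P → finrank ℂ (incidentTo η P) = 1 := fun P hP =>
    h.finrank_incidentTo hq (k := 2) (by omega) (isGenerator_iff.1 hP).2 hP.1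
  have hline' : ∀ m, IsGenerator q' 1 m → incidentTo η (incidentTo η.flip m) = m := fun m hm =>
    incidentTo_flip_incidentTo_of_isGenerator_one h' (ρ := ψ) (by exact h) hq' hq hm
  have hgen' : ∀ m, IsGenerator q' 1 m → IsGenerator q 1 (incidentTo η.flip m) := fun m hm =>
    isGenerator_one_incidentTo h' (ρ := ψ) (by exact h) hq' hm
  refine ⟨fun U hU => ?_, fun R hR => ?_, fun P hP => ?_, fun U hU R hUR => ?_, ⟨?_, ?_, ?_⟩,
    fun U hU R hUR => ?_⟩
  · obtain ⟨hU, h1⟩ := (hF U).1 hU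
    exact exists_definesPoint h' (ne_bot_of_finrank_eq_succ hU.1) h1
  · have hU := isGenerator_incidentTo_flip_submodule h h' hq' hR
    have hle : R.submodule ≤ incidentTo η (incidentTo η.flip R.submodule) :=
      le_incidentTo_flip (φ := η.flip)
    have h1 : finrank ℂ (incidentTo η (incidentTo η.flip R.submodule)) = 1 := by
      have h2 := h.finrank_incidentTo_add_eq_one hq (isGenerator_iff.1 hU).2 hU.1
      have h3 := Submodule.finrank_mono hle
      rw [R.finrank_submodule] at h3
      omega
    refine ⟨_, ⟨(hF _).2 ⟨hU, h1⟩,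
      (Submodule.eq_of_le_of_finrank_eq hle (R.finrank_submodule.trans h1.symm)).symm⟩, ?_⟩
    rintro U ⟨hU, hUR⟩
    exact (hflip U ((hF U).1 hU).1 R hUR).symm
  · exact exists_definesPoint h' (ne_bot_of_finrank_eq_succ hP.1) (hplane P hP)
  · ext P
    refine and_congr_right fun hP => ⟨fun hPR => ?_, fun hPU => ?_⟩
    · rw [← hflip U ((hF U).1 hU).1 R hUR, ← show incidentTo η P = R.submodule from hPR]
      exact le_incidentTo_flip
    · have hle : R.submodule ≤ incidentTo η P :=
        (show incidentTo η U = R.submodule from hUR) ▸ incidentTo_anti hPU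
      exact (Submodule.eq_of_le_of_finrank_eq hle
        (R.finrank_submodule.trans (hplane P hP).symm)).symm
  · exact fun l hl => isGenerator_one_incidentTo h h' hq hl
  · intro l hl l' hl' heq
    rw [← incidentTo_flip_incidentTo_of_isGenerator_one h h' hq hq' hl, heq,
      incidentTo_flip_incidentTo_of_isGenerator_one h h' hq hq' hl']
  · exact fun m hm => ⟨_, hgen' m hm, hline' m hm⟩
  · ext m
    constructor
    · rintro ⟨l, ⟨hl, hlU⟩, rfl⟩
      exact ⟨isGenerator_one_incidentTo h h' hq hl,
        (show incidentTo η U = R.submodule from hUR) ▸ incidentTo_anti hlU⟩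
    · rintro ⟨hm, hRm⟩
      refine ⟨_, ⟨hgen' m hm, ?_⟩, hline' m hm⟩
      rw [← hflip U ((hF U).1 hU).1 R hUR]
      exact incidentTo_anti hRm

end Passage

/-! ### The complex octonions -/

/-- The coordinates of the octonion product, from the Cayley–Dickson doubling
`(a, b) (c, d) = (a c - d̄ b, d a + b c̄)` of the quaternions. -/
def octonionMulFun (x y : 𝕍) : 𝕍 :=
  ![
    x 0 * y 0 - x 1 * y 1 - x 2 * y 2 - x 3 * y 3 - x 4 * y 4
      - x 5 * y 5 - x 6 * y 6 - x 7 * y 7,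
    x 0 * y 1 + x 1 * y 0 + x 2 * y 3 - x 3 * y 2 + x 4 * y 5
      - x 5 * y 4 - x 6 * y 7 + x 7 * y 6,
    x 0 * y 2 - x 1 * y 3 + x 2 * y 0 + x 3 * y 1 + x 4 * y 6
      + x 5 * y 7 - x 6 * y 4 - x 7 * y 5,
    x 0 * y 3 + x 1 * y 2 - x 2 * y 1 + x 3 * y 0 + x 4 * y 7
      - x 5 * y 6 + x 6 * y 5 - x 7 * y 4,
    x 0 * y 4 - x 1 * y 5 - x 2 * y 6 - x 3 * y 7 + x 4 * y 0
      + x 5 * y 1 + x 6 * y 2 + x 7 * y 3,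
    x 0 * y 5 + x 1 * y 4 - x 2 * y 7 + x 3 * y 6 - x 4 * y 1
      + x 5 * y 0 - x 6 * y 3 + x 7 * y 2,
    x 0 * y 6 + x 1 * y 7 + x 2 * y 4 - x 3 * y 5 - x 4 * y 2
      + x 5 * y 3 + x 6 * y 0 - x 7 * y 1,
    x 0 * y 7 - x 1 * y 6 + x 2 * y 5 + x 3 * y 4 - x 4 * y 3
      - x 5 * y 2 + x 6 * y 1 + x 7 * y 0]

/-- The product of the complex octonions, as a bilinear map. -/
def octonionMul : 𝕍 →ₗ[ℂ] 𝕍 →ₗ[ℂ] 𝕍 :=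
  LinearMap.mk₂ ℂ octonionMulFun
    (fun x x' y => by ext i; fin_cases i <;> simp [octonionMulFun] <;> ring)
    (fun c x y => by ext i; fin_cases i <;> simp [octonionMulFun] <;> ring)
    (fun x y y' => by ext i; fin_cases i <;> simp [octonionMulFun] <;> ring)
    (fun c x y => by ext i; fin_cases i <;> simp [octonionMulFun] <;> ring)

/-- Octonion conjugation, as a linear equivalence. -/
def octonionConj : 𝕍 ≃ₗ[ℂ] 𝕍 :=
  LinearEquiv.ofInvolutive
    { toFun := fun x i => if i = 0 then x i else -x i
      map_add' := fun x y => by ext i; by_cases h : i = 0 <;> simp [h]; ring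
      map_smul' := fun c x => by ext i; by_cases h : i = 0 <;> simp [h] }
    (fun x => by ext i; by_cases h : i = 0 <;> simp [h])

/-- The octonion norm form, the sum of the squares of the coordinates. -/
noncomputable def octonionNorm : QuadraticForm ℂ 𝕍 :=
  QuadraticMap.weightedSumSquares ℂ (1 : Fin 8 → ℂ)

theorem octonionConj_apply (x : 𝕍) (i : Fin 8) :
    octonionConj x i = if i = 0 then x i else -x i := rfl

theorem octonionConj_conj (x : 𝕍) : octonionConj (octonionConj x) = x := by
  ext i; by_cases h : i = 0 <;> simp [octonionConj_apply, h]

theorem octonionNorm_apply (x : 𝕍) : octonionNorm x = ∑ i, x i * x i := by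
  simp [octonionNorm, QuadraticMap.weightedSumSquares_apply]

theorem octonionNorm_conj (x : 𝕍) : octonionNorm (octonionConj x) = octonionNorm x := by
  simp [octonionNorm_apply, octonionConj_apply, Fin.sum_univ_eight]

theorem conj_mul_mul (x y : 𝕍) :
    octonionMul (octonionConj x) (octonionMul x y) = octonionNorm x • y := by
  rw [octonionNorm_apply, Fin.sum_univ_eight]
  ext i
  fin_cases i <;> simp [octonionMul, octonionMulFun, octonionConj_apply] <;> ring

theorem mul_mul_conj (x y : 𝕍) :
    octonionMul (octonionMul x y) (octonionConj y) = octonionNorm y • x := by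
  rw [octonionNorm_apply, Fin.sum_univ_eight]
  ext i
  fin_cases i <;> simp [octonionMul, octonionMulFun, octonionConj_apply] <;> ring

/-! ### Octonionic incidence relations -/

section Octonionic

variable {q : QuadraticForm ℂ 𝕍} {m : 𝕍 →ₗ[ℂ] 𝕍 →ₗ[ℂ] 𝕍}

theorem exists_isometry_octonionNorm
    (hq : (QuadraticMap.associated (R := ℂ) q).Nondegenerate) :
    ∃ σ : 𝕍 ≃ₗ[ℂ] 𝕍, ∀ x, octonionNorm (σ x) = q x := by
  have h := QuadraticForm.equivalent_weightedSumSquares_of_isAlgClosed q hq.1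
  rw [finrank_fin_fun] at h
  obtain ⟨e⟩ := h
  exact ⟨e.toLinearEquiv, e.map_app⟩

theorem isCliffordPair_compl₁₂
    (hm : ∀ x y, m (octonionConj x) (m x y) = octonionNorm x • y) {σ : 𝕍 ≃ₗ[ℂ] 𝕍}
    (hσ : ∀ x, octonionNorm (σ x) = q x) (τ : 𝕍 ≃ₗ[ℂ] 𝕍) :
    IsCliffordPair q (m.compl₁₂ σ.toLinearMap τ.toLinearMap)
      ((m ∘ₗ (σ.trans octonionConj).toLinearMap).compr₂ τ.symm.toLinearMap) := by
  refine ⟨fun x r => ?_, fun x s => ?_⟩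
  · simp [hm, hσ]
  · have := hm (octonionConj (σ x)) s
    rw [octonionConj_conj, octonionNorm_conj, hσ] at this
    simpa using this

theorem finrank_incidentTo_compl₁₂ (σ τ : 𝕍 ≃ₗ[ℂ] 𝕍) (W : Submodule ℂ 𝕍) :
    finrank ℂ (incidentTo (m.compl₁₂ σ.toLinearMap τ.toLinearMap) W) =
      finrank ℂ (incidentTo (m ∘ₗ σ.toLinearMap) W) := by
  have h : incidentTo (m ∘ₗ σ.toLinearMap) W =
      (incidentTo (m.compl₁₂ σ.toLinearMap τ.toLinearMap) W).map τ.toLinearMap := by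
    ext r
    constructor
    · exact fun hr => ⟨τ.symm r, fun x hx => by simpa using hr x hx, by simp⟩
    · rintro ⟨r, hr, rfl⟩ x hx
      exact hr x hx
  rw [h]
  exact (LinearEquiv.finrank_map_eq τ _).symm

/-- An isometry with the octonion norm form may be chosen so that a given maximal generator has an
incident point: otherwise follow it by conjugation, which interchanges the two members of the
Clifford pair and hence the two families. -/
theorem exists_isometry_finrank_incidentTo_eq_one
    (hm : ∀ x y, m (octonionConj x) (m x y) = octonionNorm x • y)
    (hq : (QuadraticMap.associated (R := ℂ) q).Nondegenerate) {U : Submodule ℂ 𝕍}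
    (hU : IsGenerator q 3 U) :
    ∃ σ : 𝕍 ≃ₗ[ℂ] 𝕍, (∀ x, octonionNorm (σ x) = q x) ∧
      ∀ τ : 𝕍 ≃ₗ[ℂ] 𝕍,
        finrank ℂ (incidentTo (m.compl₁₂ σ.toLinearMap τ.toLinearMap) U) = 1 := by
  obtain ⟨σ, hσ⟩ := exists_isometry_octonionNorm hq
  have h : IsCliffordPair q (m ∘ₗ σ.toLinearMap)
      (m ∘ₗ (σ.trans octonionConj).toLinearMap) :=
    isCliffordPair_compl₁₂ hm hσ (LinearEquiv.refl ℂ 𝕍)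
  have h1 := h.finrank_incidentTo_add_eq_one (polarBilin_nondegenerate hq)
    (isGenerator_iff.1 hU).2 hU.1
  simp only [finrank_incidentTo_compl₁₂]
  by_cases h2 : finrank ℂ (incidentTo (m ∘ₗ σ.toLinearMap) U) = 1
  · exact ⟨σ, hσ, fun _ => h2⟩
  · exact ⟨σ.trans octonionConj, fun x => by simp [octonionNorm_conj, hσ], fun _ => by omega⟩

theorem flip_conj_mul_mul (x y : 𝕍) :
    octonionMul.flip (octonionConj x) (octonionMul.flip x y) = octonionNorm x • y :=
  mul_mul_conj y x

/-- A family consists of the maximal generators that have an incident point, as soon as the fixed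
generator that determines the family has one. -/
theorem mem_family_iff {η ψ : 𝕍 →ₗ[ℂ] 𝕍 →ₗ[ℂ] 𝕍} (h : IsCliffordPair q η ψ)
    (hq : q.polarBilin.Nondegenerate) {U : Submodule ℂ 𝕍} (hU : IsGenerator q 3 U)
    (h1 : finrank ℂ (incidentTo η U) = 1) (W : Submodule ℂ 𝕍) :
    W ∈ {W | IsGenerator q 3 W ∧ Even (finrank ℂ (U ⊓ W : Submodule ℂ 𝕍))} ↔
      IsGenerator q 3 W ∧ finrank ℂ (incidentTo η W) = 1 := by
  refine and_congr_right fun hW => ?_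
  rw [← h.finrank_incidentTo_eq_iff_even hq (isGenerator_iff.1 hU).2 hU.1
    (isGenerator_iff.1 hW).2 hW.1, h1, eq_comm]

theorem quadric_nonempty (hq : (QuadraticMap.associated (R := ℂ) q).Nondegenerate) :
    (quadric q).Nonempty := by
  obtain ⟨σ, hσ⟩ := exists_isometry_octonionNorm hq
  -- the octonion `1 + i e₁` is a null vector
  refine ⟨Projectivization.mk ℂ (σ.symm ![1, Complex.I, 0, 0, 0, 0, 0, 0]) (by simp), ?_⟩
  rw [mk_mem_quadric, ← hσ]
  simp [octonionNorm_apply, Fin.sum_univ_eight]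

theorem exists_isFamily (hq : (QuadraticMap.associated (R := ℂ) q).Nondegenerate) :
    ∃ F, IsFamily q F := by
  obtain ⟨σ, hσ⟩ := exists_isometry_octonionNorm hq
  obtain ⟨R, hR⟩ := quadric_nonempty hq
  exact ⟨_, _, isGenerator_incidentTo_flip_submodule
    (isCliffordPair_compl₁₂ conj_mul_mul hσ σ)
    (isCliffordPair_compl₁₂ flip_conj_mul_mul hσ σ) (polarBilin_nondegenerate hq) hR, rfl⟩

end Octonionic

/-- The triality principle for two nonsingular quadrics in `CP7`. -/
theorem theorem1 (ε g : QuadraticForm ℂ (Fin 8 → ℂ))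
    (hε : (QuadraticMap.associated (R := ℂ) ε).Nondegenerate)
    (hg : (QuadraticMap.associated (R := ℂ) g).Nondegenerate) :
    (∃ F, IsFamily ε F) ∧ (∃ G, IsFamily g G) ∧
    ∀ F G : Set (Submodule ℂ (Fin 8 → ℂ)), IsFamily ε F → IsFamily g G →
      ∃ η : (Fin 8 → ℂ) →ₗ[ℂ] (Fin 8 → ℂ) →ₗ[ℂ] (Fin 8 → ℂ),
        TrialityPassage η ε g F ∧ TrialityPassage η.flip g ε G := by
  refine ⟨exists_isFamily hε, exists_isFamily hg, ?_⟩
  rintro _ _ ⟨U, hU, rfl⟩ ⟨V, hV, rfl⟩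
  obtain ⟨σ, hσ, hσU⟩ := exists_isometry_finrank_incidentTo_eq_one conj_mul_mul hε hU
  obtain ⟨τ, hτ, hτV⟩ := exists_isometry_finrank_incidentTo_eq_one flip_conj_mul_mul hg hV
  have hε' := polarBilin_nondegenerate hε
  have hg' := polarBilin_nondegenerate hg
  have h := isCliffordPair_compl₁₂ conj_mul_mul hσ τ
  have h' := isCliffordPair_compl₁₂ flip_conj_mul_mul hτ σ
  exact ⟨octonionMul.compl₁₂ σ.toLinearMap τ.toLinearMap,
    trialityPassage_of_isCliffordPair h h' hε' hg' (mem_family_iff h hε' hU (hσU τ)),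
    trialityPassage_of_isCliffordPair h' h hg' hε' (mem_family_iff h' hg' hV (hτV σ))⟩
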